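/- Let $\Lambda\subset\mathbb{R}^n$ be a lattice of full rank, let $T^n=\mathbb{R}^n/\Lambda$ be the flat torus with the metric induced by the standard metric of $\mathbb{R}^n$, let $1\le p\le n$ and let $\alpha,\beta,\alpha',\beta'>0$ be real numbers. On smooth (complex-valued) differential $p$-forms on $T^n$ consider the operator $F_{\alpha\beta,p}=\alpha\, d\delta+\beta\,\delta d$, where $d$ is the exterior derivative and $\delta$ its formal $L^2$-adjoint. Call $F_{\alpha\beta,p}$ and $F_{\alpha'\beta',p}$ isospectral if $\dim\ker(F_{\alpha\beta,p}-\lambda)=\dim\ker(F_{\alpha'\beta',p}-\lambda)$ for every $\lambda\in\mathbb{C}$, i.e. if they have the same eigenvalues with the same multiplicities. Then: 1. If $p<n$ and $n\ne 2p$, then $F_{\alpha\beta,p}$ and $F_{\alpha'\beta',p}$ are isospectral if and only if $(\alpha,\beta)=(\alpha',\beta')$. 2. If $n=2p$, then $F_{\alpha\beta,p}$ and $F_{\alpha'\beta',p}$ are isospectral if and only if $\{\alpha,\beta\}=\{\alpha',\beta'\}$. 3. If $p=n$ (where $\delta d=0$, so that $F_{\alpha\beta,n}=\alpha\, d\delta$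 does not depend on $\beta$), then $F_{\alpha\beta,n}$ and $F_{\alpha'\beta',n}$ are isospectral if and only if $\alpha=\alpha'$. -/

import Mathlib

noncomputable section

namespace FlatTorus

/-- Euclidean space `ℝⁿ` with its standard metric. -/
abbrev Euc (n : ℕ) : Type := EuclideanSpace ℝ (Fin n)

/-- `Λᵖ(ℝⁿ)* ⊗ ℂ`: alternating `ℝ`-multilinear `p`-forms on `ℝⁿ` with values in `ℂ`. -/
abbrev AltForm (n p : ℕ) : Type := Euc n [⋀^Fin p]→L[ℝ] ℂ

variable {n : ℕ} (Λ : Submodule ℤ (Euc n))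

/-- The torus `ℝⁿ / Λ`. -/
abbrev Torus : Type := Euc n ⧸ Λ.toAddSubgroup

/-- The canonical projection `ℝⁿ → ℝⁿ / Λ`. -/
abbrev proj (x : Euc n) : Torus Λ := QuotientAddGroup.mk x

/-- The space `Ωᵖ(ℝⁿ/Λ, ℂ)` of smooth complex-valued `p`-forms. All tangent spaces of `ℝⁿ/Λ` are
identified with `ℝⁿ` through the differential of the projection (a local isometry), so that a form
is a map from the torus to `Λᵖ(ℝⁿ)* ⊗ ℂ`; it is smooth if and only if its pullback to `ℝⁿ` is. -/
def SmoothForm (p : ℕ) : Submodule ℂ (Torus Λ → AltForm n p) where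
  carrier := {ω | ContDiff ℝ (⊤ : ℕ∞) fun x => ω (proj Λ x)}
  add_mem' {a b} ha hb := by
    change ContDiff ℝ (⊤ : ℕ∞) fun x => a (proj Λ x) + b (proj Λ x)
    exact ContDiff.add ha hb
  zero_mem' := by
    change ContDiff ℝ (⊤ : ℕ∞) fun _ : Euc n => (0 : AltForm n p)
    exact contDiff_const
  smul_mem' c a h := by
    change ContDiff ℝ (⊤ : ℕ∞) fun x => c • a (proj Λ x)
    exact ContDiff.const_smul c h

variable {Λ}

/-- The pullback to `ℝⁿ` of a form on `ℝⁿ / Λ`. -/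
def pull {p : ℕ} (ω : SmoothForm Λ p) (x : Euc n) : AltForm n p := ω.1 (proj Λ x)

theorem contDiff_pull {p : ℕ} (ω : SmoothForm Λ p) : ContDiff ℝ (⊤ : ℕ∞) (pull ω) := ω.2

theorem proj_add (x : Euc n) {v : Euc n} (hv : v ∈ Λ) : proj Λ (x + v) = proj Λ x := by
  rw [QuotientAddGroup.eq]
  simpa using Λ.neg_mem hv

theorem pull_add_lattice {p : ℕ} (ω : SmoothForm Λ p) (x : Euc n) {v : Euc n} (hv : v ∈ Λ) :
    pull ω (x + v) = pull ω x := by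
  simp only [pull, proj_add x hv]

theorem fderiv_pull_add_lattice {p : ℕ} (ω : SmoothForm Λ p) (x : Euc n) {v : Euc n}
    (hv : v ∈ Λ) : fderiv ℝ (pull ω) (x + v) = fderiv ℝ (pull ω) x := by
  rw [← fderiv_comp_add_right]
  congr 1
  funext y
  exact pull_add_lattice ω y hv

theorem pull_injective {p : ℕ} : Function.Injective (pull : SmoothForm Λ p → _) := by
  intro ω η h
  apply Subtype.ext
  funext t
  obtain ⟨x, rfl⟩ := QuotientAddGroup.mk_surjective t
  exact congrFun h x

/-- The smooth form on `ℝⁿ / Λ` whose pullback is a given smooth `Λ`-periodic form on `ℝⁿ`. -/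
def descend {p : ℕ} (f : Euc n → AltForm n p) (hf : ContDiff ℝ (⊤ : ℕ∞) f)
    (hper : ∀ x, ∀ v ∈ Λ, f (x + v) = f x) : SmoothForm Λ p :=
  ⟨Quotient.lift f (by
    intro a b h
    have h' : -a + b ∈ Λ := QuotientAddGroup.leftRel_apply.mp h
    simpa using (hper a _ h').symm), hf⟩

theorem pull_descend {p : ℕ} (f : Euc n → AltForm n p) (hf : ContDiff ℝ (⊤ : ℕ∞) f)
    (hper : ∀ x, ∀ v ∈ Λ, f (x + v) = f x) : pull (descend f hf hper) = f := rfl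

theorem fderiv_pull_add {p : ℕ} (ω η : SmoothForm Λ p) (x : Euc n) :
    fderiv ℝ (pull (ω + η)) x = fderiv ℝ (pull ω) x + fderiv ℝ (pull η) x :=
  fderiv_add ((contDiff_pull ω).differentiable (by simp) x)
    ((contDiff_pull η).differentiable (by simp) x)

theorem fderiv_pull_smul {p : ℕ} (c : ℂ) (ω : SmoothForm Λ p) (x : Euc n) :
    fderiv ℝ (pull (c • ω)) x = c • fderiv ℝ (pull ω) x :=
  fderiv_const_smul ((contDiff_pull ω).differentiable (by simp) x) c

/-- The exterior derivative `d : Ωᵖ → Ωᵖ⁺¹`, computed on pullbacks to `ℝⁿ`. -/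
def d (p : ℕ) : SmoothForm Λ p →ₗ[ℂ] SmoothForm Λ (p + 1) where
  toFun ω := descend (extDeriv (pull ω))
    ((ContinuousAlternatingMap.alternatizeUncurryFinCLM ℝ (Euc n) ℂ).contDiff.comp
      ((contDiff_pull ω).fderiv_right (by simp)))
    (fun x v hv => by simp only [extDeriv, fderiv_pull_add_lattice ω x hv])
  map_add' ω η := by
    apply pull_injective
    funext x
    change extDeriv (pull (ω + η)) x = extDeriv (pull ω) x + extDeriv (pull η) x
    simp only [extDeriv, fderiv_pull_add, ContinuousAlternatingMap.alternatizeUncurryFin_add]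
  map_smul' c ω := by
    apply pull_injective
    funext x
    change extDeriv (pull (c • ω)) x = c • extDeriv (pull ω) x
    simp only [extDeriv, fderiv_pull_smul]
    exact ContinuousAlternatingMap.alternatizeUncurryFin_smul _ _

theorem pull_d {p : ℕ} (ω : SmoothForm Λ p) : pull (d p ω) = extDeriv (pull ω) := rfl

/-- The `i`-th standard basis vector `∂ᵢ`. -/
abbrev stdVec (i : Fin n) : Euc n := EuclideanSpace.single i (1 : ℝ)

/-- Interior multiplication `v ↦ v ⌟ a`, linear and continuous in both arguments. -/
def interior (p : ℕ) : AltForm n (p + 1) →L[ℝ] Euc n →L[ℝ] AltForm n p :=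
  (ContinuousAlternatingMap.curryLeftLI (𝕜 := ℝ) (E := Euc n) (F := ℂ)
    (n := p)).toContinuousLinearMap

theorem interior_apply {p : ℕ} (a : AltForm n (p + 1)) (v : Euc n) (w : Fin p → Euc n) :
    interior p a v w = a (Matrix.vecCons v w) := rfl

/-- The co-derivative `- ∑ᵢ ∂ᵢ ⌟ ∇_{∂ᵢ} η` of a `(p+1)`-form on `ℝⁿ`. -/
def euclCodiff {p : ℕ} (η : Euc n → AltForm n (p + 1)) (x : Euc n) : AltForm n p :=
  -∑ i : Fin n, interior p (fderiv ℝ η x (stdVec i)) (stdVec i)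

theorem contDiff_euclCodiff {p : ℕ} {η : Euc n → AltForm n (p + 1)}
    (hη : ContDiff ℝ (⊤ : ℕ∞) η) : ContDiff ℝ (⊤ : ℕ∞) (euclCodiff η) := by
  have h1 : ∀ i : Fin n, ContDiff ℝ (⊤ : ℕ∞) fun x => fderiv ℝ η x (stdVec i) := fun i =>
    (hη.fderiv_right (m := (⊤ : ℕ∞)) (by simp)).clm_apply contDiff_const
  have h2 : ∀ i : Fin n, ContDiff ℝ (⊤ : ℕ∞)
      fun x => interior p (fderiv ℝ η x (stdVec i)) (stdVec i) := fun i =>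
    ((interior p).contDiff.comp (h1 i)).clm_apply contDiff_const
  have h3 : ContDiff ℝ (⊤ : ℕ∞)
      fun x => -∑ i : Fin n, interior p (fderiv ℝ η x (stdVec i)) (stdVec i) :=
    (ContDiff.sum fun i _ => h2 i).neg
  exact h3

/-- The co-derivative `δ : Ωᵖ⁺¹ → Ωᵖ`, computed on pullbacks to `ℝⁿ`. It is the formal adjoint
of `d` for the `L²`-scalar product: see `l2Inner_d_left`. -/
def codiff (p : ℕ) : SmoothForm Λ (p + 1) →ₗ[ℂ] SmoothForm Λ p where
  toFun η := descend (euclCodiff (pull η))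
    (contDiff_euclCodiff (contDiff_pull η))
    (fun x v hv => by simp only [euclCodiff, fderiv_pull_add_lattice η x hv])
  map_add' ω η := by
    apply pull_injective
    funext x
    change euclCodiff (pull (ω + η)) x = euclCodiff (pull ω) x + euclCodiff (pull η) x
    simp only [euclCodiff, fderiv_pull_add, add_apply, map_add,
      Finset.sum_add_distrib, neg_add]
  map_smul' c ω := by
    apply pull_injective
    funext x
    change euclCodiff (pull (c • ω)) x = c • euclCodiff (pull ω) x
    have h : ∀ (a : AltForm n (p + 1)) (v : Euc n), interior p (c • a) v = c • interior p a v :=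
      fun _ _ => rfl
    simp only [euclCodiff, fderiv_pull_smul, smul_apply, h,
      Finset.smul_sum, smul_neg]

theorem pull_codiff {p : ℕ} (η : SmoothForm Λ (p + 1)) :
    pull (codiff p η) = euclCodiff (pull η) := rfl

/-- The Hermitian scalar product on `Λᵖ(ℝⁿ)* ⊗ ℂ` induced by the standard metric:
`∑_{i₁ < … < iₚ} a(∂_{i₁}, …, ∂_{iₚ}) conj b(∂_{i₁}, …, ∂_{iₚ})`, written as a sum over all
multi-indices divided by `p!`. -/
def altInner {p : ℕ} (a b : AltForm n p) : ℂ :=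
  ((p.factorial : ℂ))⁻¹ * ∑ I : Fin p → Fin n,
    a (fun k => stdVec (I k)) * (starRingEnd ℂ) (b fun k => stdVec (I k))

theorem contDiff_coeff {p : ℕ} (ω : SmoothForm Λ p) (w : Fin p → Euc n) :
    ContDiff ℝ (⊤ : ℕ∞) fun x => pull ω x w :=
  (ContinuousAlternatingMap.apply ℝ (Euc n) ℂ w).contDiff.comp (contDiff_pull ω)

theorem fderiv_coeff {p : ℕ} (ω : SmoothForm Λ p) (w : Fin p → Euc n) (x v : Euc n) :
    fderiv ℝ (fun x => pull ω x w) x v = fderiv ℝ (pull ω) x v w := by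
  have h := (ContinuousAlternatingMap.apply ℝ (Euc n) ℂ w).hasFDerivAt.comp x
    ((contDiff_pull ω).differentiable (by simp) x).hasFDerivAt
  exact congrFun (congrArg DFunLike.coe h.fderiv) v

theorem altInner_alternatize {p : ℕ} (L : Euc n →L[ℝ] AltForm n p) (b : AltForm n (p + 1)) :
    altInner (ContinuousAlternatingMap.alternatizeUncurryFin L) b =
      ((p.factorial : ℂ))⁻¹ * ∑ I : Fin p → Fin n, ∑ i : Fin n,
        L (stdVec i) (fun k => stdVec (I k)) *
          (starRingEnd ℂ) (b (Matrix.vecCons (stdVec i) fun k => stdVec (I k))) := by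
  have hterm : ∀ k : Fin (p + 1),
      ∑ I : Fin (p + 1) → Fin n, ((-1 : ℤ) ^ (k : ℕ) • L (stdVec (I k))
        (k.removeNth fun j => stdVec (I j))) * (starRingEnd ℂ) (b fun j => stdVec (I j)) =
      ∑ I : Fin p → Fin n, ∑ i : Fin n, L (stdVec i) (fun k => stdVec (I k)) *
          (starRingEnd ℂ) (b (Matrix.vecCons (stdVec i) fun k => stdVec (I k))) := by
    intro k
    rw [← (Fin.insertNthEquiv (fun _ => Fin n) k).sum_comp, Fintype.sum_prod_type,
      Finset.sum_comm]
    refine Finset.sum_congr rfl fun I _ => Finset.sum_congr rfl fun i _ => ?_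
    have h1 : (fun j => (stdVec ((Fin.insertNthEquiv (fun _ => Fin n) k) (i, I) j) : Euc n)) =
        k.insertNth (stdVec i) fun j => stdVec (I j) := by
      funext j
      refine Fin.succAboveCases k ?_ (fun j => ?_) j <;> simp
    rw [h1, ContinuousAlternatingMap.map_insertNth]
    have h2 : (stdVec ((Fin.insertNthEquiv (fun _ => Fin n) k) (i, I) k) : Euc n) = stdVec i := by
      simp
    rw [h2, Fin.removeNth_insertNth]
    have h3 : ((-1 : ℂ) ^ (k : ℕ)) * (-1) ^ (k : ℕ) = 1 := by
      rw [← mul_pow]; simp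
    simp only [zsmul_eq_mul, map_mul, map_pow, map_neg, map_one, Int.cast_pow, Int.cast_neg,
      Int.cast_one]
    linear_combination (L (stdVec i) (fun k => stdVec (I k)) *
      (starRingEnd ℂ) (b (Matrix.vecCons (stdVec i) fun k => stdVec (I k)))) * h3
  unfold altInner
  simp only [ContinuousAlternatingMap.alternatizeUncurryFin_apply, Finset.sum_mul]
  rw [Finset.sum_comm, Finset.sum_congr rfl fun k _ => hterm k, Finset.sum_const,
    Finset.card_univ, Fintype.card_fin, nsmul_eq_mul, Nat.factorial_succ, Nat.cast_mul,
    mul_inv, ← mul_assoc]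
  congr 1
  have : ((p + 1 : ℕ) : ℂ) ≠ 0 := by exact_mod_cast Nat.succ_ne_zero p
  field_simp

section L2

variable [DiscreteTopology Λ] [IsZLattice ℝ Λ]

variable (Λ) in
/-- A fundamental parallelepiped of `Λ`. -/
def fundDomain : Set (Euc n) :=
  ZSpan.fundamentalDomain ((Module.Free.chooseBasis ℤ Λ).ofZLatticeBasis ℝ Λ)

variable (Λ) in
/-- The Riemannian volume measure of `ℝⁿ / Λ`. -/
def torusMeasure : MeasureTheory.Measure (Torus Λ) :=
  MeasureTheory.Measure.map (proj Λ) (MeasureTheory.volume.restrict (fundDomain Λ))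

/-- The `L²`-scalar product of smooth forms on `ℝⁿ / Λ`. -/
def l2Inner {p : ℕ} (ω η : SmoothForm Λ p) : ℂ :=
  ∫ t, altInner (ω.1 t) (η.1 t) ∂(torusMeasure Λ)

open MeasureTheory in
open scoped Pointwise in
theorem setIntegral_add_eq (g : Euc n → ℂ) (hper : ∀ x, ∀ v ∈ Λ, g (x + v) = g x) (v : Euc n) :
    ∫ x in fundDomain Λ, g (x + v) = ∫ x in fundDomain Λ, g x := by
  have hD : IsAddFundamentalDomain Λ (fundDomain Λ) (volume : Measure (Euc n)) :=
    ZLattice.isAddFundamentalDomain (Module.Free.chooseBasis ℤ Λ) volume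
  have hinv : VAddInvariantMeasure Λ (Euc n) volume :=
    inferInstanceAs <| VAddInvariantMeasure Λ.toAddSubgroup (Euc n) volume
  have hD' : IsAddFundamentalDomain Λ (v +ᵥ fundDomain Λ) (volume : Measure (Euc n)) :=
    hD.vadd_of_comm v
  have h1 : ∫ x in fundDomain Λ, g x = ∫ x in v +ᵥ fundDomain Λ, g x := by
    refine hD.setIntegral_eq hD' fun w x => ?_
    rw [Submodule.vadd_def, vadd_eq_add, add_comm]
    exact hper x w w.2
  rw [h1]
  have h2 := (measurePreserving_add_left (volume : Measure (Euc n)) v).setIntegral_image_emb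
    (measurableEmbedding_addLeft v) g (fundDomain Λ)
  have h3 : (fun x => v + x) '' fundDomain Λ = v +ᵥ fundDomain Λ := rfl
  rw [← h3, h2]
  simp only [add_comm]

open MeasureTheory in
theorem integrableOn_fundDomain {g : Euc n → ℂ} (hg : Continuous g) :
    IntegrableOn g (fundDomain Λ) :=
  (hg.continuousOn.integrableOn_compact (ZSpan.fundamentalDomain_isBounded
    ((Module.Free.chooseBasis ℤ Λ).ofZLatticeBasis ℝ Λ)).isCompact_closure).mono_set
    subset_closure

open MeasureTheory in
theorem setIntegral_fderiv_eq_zero {g : Euc n → ℂ} (hg : ContDiff ℝ (⊤ : ℕ∞) g)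
    (hper : ∀ x, ∀ v ∈ Λ, g (x + v) = g x) (v : Euc n) :
    ∫ x in fundDomain Λ, fderiv ℝ g x v = 0 := by
  have hbd : Bornology.IsBounded (fundDomain Λ) := ZSpan.fundamentalDomain_isBounded
    ((Module.Free.chooseBasis ℤ Λ).ofZLatticeBasis ℝ Λ)
  have hmeas : MeasurableSet (fundDomain Λ) := ZSpan.fundamentalDomain_measurableSet _
  obtain ⟨R, hR⟩ := hbd.exists_norm_le
  have hcont : Continuous fun x => fderiv ℝ g x v :=
    (hg.continuous_fderiv (by simp)).clm_apply continuous_const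
  obtain ⟨C, hC⟩ := (isCompact_closedBall (0 : Euc n) (R + ‖v‖)).exists_bound_of_continuousOn
    hcont.continuousOn
  have hfin : volume (fundDomain Λ) < ⊤ := hbd.measure_lt_top
  have : IsFiniteMeasure (volume.restrict (fundDomain Λ)) := ⟨by simpa using hfin⟩
  have hline : ∀ (x : Euc n) (t : ℝ),
      HasDerivAt (fun s : ℝ => g (x + s • v)) (fderiv ℝ g (x + t • v) v) t := by
    intro x t
    have h1 : HasDerivAt (fun s : ℝ => x + s • v) v t := by
      simpa using ((hasDerivAt_id t).smul_const v).const_add x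
    exact ((hg.differentiable (by simp) _).hasFDerivAt).comp_hasDerivAt t h1
  have key := hasDerivAt_integral_of_dominated_loc_of_deriv_le
    (μ := volume.restrict (fundDomain Λ)) (F := fun (t : ℝ) x => g (x + t • v))
    (F' := fun t x => fderiv ℝ g (x + t • v) v) (x₀ := (0 : ℝ)) (s := Metric.ball 0 1)
    (bound := fun _ => C) (Metric.ball_mem_nhds _ one_pos)
    (Filter.Eventually.of_forall fun t =>
      (hg.continuous.comp (continuous_id.add continuous_const)).aestronglyMeasurable)
    (integrableOn_fundDomain (hg.continuous.comp (continuous_id.add continuous_const)))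
    (hcont.comp (continuous_id.add continuous_const)).aestronglyMeasurable
    ((ae_restrict_iff' hmeas).2 (Filter.Eventually.of_forall fun x hx t ht => by
      apply hC
      rw [mem_closedBall_zero_iff]
      have ht' : ‖t‖ ≤ 1 := by simpa using (mem_ball_zero_iff.1 ht).le
      calc ‖x + t • v‖ ≤ ‖x‖ + ‖t • v‖ := norm_add_le _ _
        _ ≤ R + ‖v‖ := by
          rw [norm_smul]
          have := hR x hx
          nlinarith [norm_nonneg v]))
    (integrable_const _)
    (Filter.Eventually.of_forall fun x t _ => hline x t)
  have hconst : (fun t : ℝ => ∫ x in fundDomain Λ, g (x + t • v)) =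
      fun _ => ∫ x in fundDomain Λ, g x := by
    funext t
    exact setIntegral_add_eq g hper (t • v)
  have h0 := key.2
  rw [hconst] at h0
  simpa using h0.unique (hasDerivAt_const (0 : ℝ) _)

theorem l2Inner_eq {p : ℕ} (ω η : SmoothForm Λ p) :
    l2Inner ω η = ∫ x in fundDomain Λ, altInner (pull ω x) (pull η x) := by
  have hc : Continuous fun x => altInner (pull ω x) (pull η x) := by
    unfold altInner
    exact continuous_const.mul (continuous_finsetSum _ fun I _ =>
      (contDiff_coeff ω _).continuous.mul
        (Complex.continuous_conj.comp (contDiff_coeff η _).continuous))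
  have hm : Measurable fun t : Torus Λ => altInner (ω.1 t) (η.1 t) :=
    QuotientAddGroup.measurable_from_quotient.2 hc.measurable
  exact MeasureTheory.integral_map QuotientAddGroup.measurable_coe.aemeasurable
    hm.aestronglyMeasurable

theorem integral_by_parts {f g : Euc n → ℂ} (hf : ContDiff ℝ (⊤ : ℕ∞) f)
    (hg : ContDiff ℝ (⊤ : ℕ∞) g) (hfp : ∀ x, ∀ v ∈ Λ, f (x + v) = f x)
    (hgp : ∀ x, ∀ v ∈ Λ, g (x + v) = g x) (v : Euc n) :
    ∫ x in fundDomain Λ, fderiv ℝ f x v * (starRingEnd ℂ) (g x) =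
      -∫ x in fundDomain Λ, f x * (starRingEnd ℂ) (fderiv ℝ g x v) := by
  have hgc : ContDiff ℝ (⊤ : ℕ∞) fun x => (starRingEnd ℂ) (g x) :=
    Complex.conjCLE.contDiff.comp hg
  have hderiv : ∀ x, fderiv ℝ (fun y => f y * (starRingEnd ℂ) (g y)) x v =
      fderiv ℝ f x v * (starRingEnd ℂ) (g x) + f x * (starRingEnd ℂ) (fderiv ℝ g x v) := by
    intro x
    have h1 := (hf.differentiable (by simp) x).hasFDerivAt
    have h2 : HasFDerivAt (fun y => (starRingEnd ℂ) (g y))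
        ((Complex.conjCLE : ℂ →L[ℝ] ℂ).comp (fderiv ℝ g x)) x :=
      (Complex.conjCLE : ℂ →L[ℝ] ℂ).hasFDerivAt.comp x
        (hg.differentiable (by simp) x).hasFDerivAt
    have h3 := (h1.mul h2).fderiv
    change fderiv ℝ (fun y => f y * (starRingEnd ℂ) (g y)) x = _ at h3
    rw [h3]
    simp
    ring
  have hc1 : Continuous fun x => fderiv ℝ f x v * (starRingEnd ℂ) (g x) :=
    ((hf.continuous_fderiv (by simp)).clm_apply continuous_const).mul hgc.continuous
  have hc2 : Continuous fun x => f x * (starRingEnd ℂ) (fderiv ℝ g x v) :=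
    hf.continuous.mul (Complex.continuous_conj.comp
      ((hg.continuous_fderiv (by simp)).clm_apply continuous_const))
  have h0 := setIntegral_fderiv_eq_zero (Λ := Λ) (hf.mul hgc)
    (fun x w hw => by simp only [hfp x w hw, hgp x w hw]) v
  simp only [hderiv] at h0
  rw [MeasureTheory.integral_add (integrableOn_fundDomain hc1) (integrableOn_fundDomain hc2)] at h0
  exact eq_neg_of_add_eq_zero_left h0

/-- `δ` is the formal adjoint of `d`: `(dω, η) = (ω, δη)`. -/
theorem l2Inner_d_left {p : ℕ} (ω : SmoothForm Λ p) (η : SmoothForm Λ (p + 1)) :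
    l2Inner (d p ω) η = l2Inner ω (codiff p η) := by
  rw [l2Inner_eq, l2Inner_eq]
  simp only [pull_d, extDeriv, altInner_alternatize, pull_codiff]
  unfold altInner
  rw [MeasureTheory.integral_const_mul, MeasureTheory.integral_const_mul]
  congr 1
  have hcd : ∀ (I : Fin p → Fin n) (x : Euc n),
      (starRingEnd ℂ) (euclCodiff (pull η) x fun k => stdVec (I k)) =
      -∑ i : Fin n, (starRingEnd ℂ) (fderiv ℝ (fun y => pull η y
        (Matrix.vecCons (stdVec i) fun k => stdVec (I k))) x (stdVec i)) := by
    intro I x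
    rw [← map_sum, ← map_neg]
    congr 1
    simp only [fderiv_coeff]
    simp [euclCodiff, interior_apply]
  simp only [hcd, ← fderiv_coeff, mul_neg, Finset.mul_sum]
  have hc1 : ∀ (I : Fin p → Fin n) (i : Fin n), Continuous fun x =>
      fderiv ℝ (fun y => pull ω y fun k => stdVec (I k)) x (stdVec i) *
        (starRingEnd ℂ) (pull η x (Matrix.vecCons (stdVec i) fun k => stdVec (I k))) := fun I i =>
    (((contDiff_coeff ω _).continuous_fderiv (by simp)).clm_apply continuous_const).mul
      (Complex.continuous_conj.comp (contDiff_coeff η _).continuous)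
  have hc2 : ∀ (I : Fin p → Fin n) (i : Fin n), Continuous fun x =>
      (pull ω x fun k => stdVec (I k)) * (starRingEnd ℂ) (fderiv ℝ (fun y => pull η y
        (Matrix.vecCons (stdVec i) fun k => stdVec (I k))) x (stdVec i)) := fun I i =>
    (contDiff_coeff ω _).continuous.mul (Complex.continuous_conj.comp
      (((contDiff_coeff η _).continuous_fderiv (by simp)).clm_apply continuous_const))
  rw [MeasureTheory.integral_finsetSum _ fun I _ => integrableOn_fundDomain
      (continuous_finsetSum _ fun i _ => hc1 I i),
    MeasureTheory.integral_finsetSum (f := fun (I : Fin p → Fin n) x => -∑ i : Fin n,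
      (pull ω x fun k => stdVec (I k)) * (starRingEnd ℂ) (fderiv ℝ (fun y => pull η y
        (Matrix.vecCons (stdVec i) fun k => stdVec (I k))) x (stdVec i))) _
      fun I _ => integrableOn_fundDomain (continuous_finsetSum _ fun i _ => hc2 I i).neg]
  refine Finset.sum_congr rfl fun I _ => ?_
  rw [MeasureTheory.integral_neg,
    MeasureTheory.integral_finsetSum _ fun i _ => integrableOn_fundDomain (hc1 I i),
    MeasureTheory.integral_finsetSum _ fun i _ => integrableOn_fundDomain (hc2 I i),
    ← Finset.sum_neg_distrib]
  refine Finset.sum_congr rfl fun i _ => ?_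
  exact integral_by_parts (contDiff_coeff ω _) (contDiff_coeff η _)
    (fun x v hv => by rw [pull_add_lattice ω x hv])
    (fun x v hv => by rw [pull_add_lattice η x hv]) (stdVec i)

end L2

/-- The operator `F_{αβ,p} = α d δ + β δ d` on `Ωᵖ(ℝⁿ/Λ, ℂ)`, where `δ = 0` on functions. -/
def F (Λ : Submodule ℤ (Euc n)) (α β : ℝ) : (p : ℕ) → Module.End ℂ (SmoothForm Λ p)
  | 0 => (β : ℂ) • (codiff 0 ∘ₗ d 0 : SmoothForm Λ 0 →ₗ[ℂ] SmoothForm Λ 0)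
  | p + 1 =>
    (α : ℂ) • (d p ∘ₗ codiff p : SmoothForm Λ (p + 1) →ₗ[ℂ] SmoothForm Λ (p + 1)) +
    (β : ℂ) • (codiff (p + 1) ∘ₗ d (p + 1) : SmoothForm Λ (p + 1) →ₗ[ℂ] SmoothForm Λ (p + 1))

/-- The eigenspace `Eig(F_{αβ,p}, μ)` of smooth forms `ω` with `F_{αβ,p} ω = μ ω`. -/
def Eig (Λ : Submodule ℤ (Euc n)) (α β : ℝ) (p : ℕ) (μ : ℂ) : Submodule ℂ (SmoothForm Λ p) :=
  Module.End.eigenspace (R := ℂ) (M := SmoothForm Λ p) (F Λ α β p) μ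

/-- The spectrum of `F_{αβ,p}`, as a weighted set: it assigns to `μ` the dimension of the
eigenspace for `μ`. -/
def Spec (Λ : Submodule ℤ (Euc n)) (α β : ℝ) (p : ℕ) (μ : ℂ) : Cardinal :=
  Module.rank ℂ (Eig Λ α β p μ)

/-- Two operators `F_{αβ,p}` and `F_{α'β',p}` on `ℝⁿ/Λ` are isospectral if they have the same
eigenvalues with the same multiplicities. -/
def Isospectral (Λ : Submodule ℤ (Euc n)) (p : ℕ) (α β α' β' : ℝ) : Prop :=
  Spec Λ α β p = Spec Λ α' β' p

end FlatTorus

end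

/-!
A plane wave `exp (i ⟪ξ, x⟫) a`, with `ξ` in the reciprocal lattice, turns `d` into exterior and `δ`
into interior multiplication by `ξ`, up to factors `± i`. By Cartan's identity, `α d δ + β δ d` acts
on the coefficient `a` as `α ‖ξ‖²` on the range of `ξ ∧ ·` and as `β ‖ξ‖²` on a complement. Fourier
completeness thus gives `μ` the multiplicity `A N(μ / α) + B N(μ / β)`, where `N` counts reciprocal
lattice vectors of given squared length, `A = (n - 1).choose (p - 1)` and `B = (n - 1).choose p`.
The dilates of `N` are linearly independent, because `N` has a shortest nonzero length in its
support; hence the spectrum determines the formal sum `A [α] + B [β]`.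
-/

noncomputable section

namespace FlatTorus

section Idempotent

open Module

variable {K V : Type*} [Field K] [AddCommGroup V] [Module K V] {e : End K V}

theorem mem_eigenspace_of_isIdempotentElem (he : IsIdempotentElem e) (a b μ : K) (x : V) :
    x ∈ End.eigenspace (a • e + b • (1 - e)) μ ↔
      (μ = a ∨ e x = 0) ∧ (μ = b ∨ x - e x = 0) := by
  have hee : e (e x) = e x := congrArg (· x) he
  have apply_eq : (a • e + b • (1 - e)) x = a • e x + b • (x - e x) := rfl
  rw [End.mem_eigenspace_iff, apply_eq]
  constructor
  · intro h
    have range_part := congrArg e h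
    simp only [map_add, map_smul, map_sub, hee, sub_self, smul_zero, add_zero] at range_part
    have ker_part : b • (x - e x) = μ • (x - e x) := by
      rw [smul_sub μ, ← range_part, ← h, add_sub_cancel_left]
    rw [← sub_eq_zero, ← sub_smul, smul_eq_zero, sub_eq_zero, eq_comm] at range_part ker_part
    exact ⟨range_part, ker_part⟩
  · rintro ⟨ha, hb⟩
    have range_part : a • e x = μ • e x := by rcases ha with rfl | h <;> simp [*]
    have ker_part : b • (x - e x) = μ • (x - e x) := by rcases hb with rfl | h <;> simp [*]
    rw [range_part, ker_part, ← smul_add, add_sub_cancel]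

open scoped Classical in
theorem finrank_eigenspace_of_isIdempotentElem [FiniteDimensional K V] (he : IsIdempotentElem e)
    (a b μ : K) :
    finrank K (End.eigenspace (a • e + b • (1 - e)) μ) =
      (if μ = a then finrank K (LinearMap.range e) else 0) +
      (if μ = b then finrank K (LinearMap.ker e) else 0) := by
  have mem_eigenspace := mem_eigenspace_of_isIdempotentElem he a b μ
  have mem_range (x : V) : x ∈ LinearMap.range e ↔ x - e x = 0 := by
    rw [LinearMap.IsIdempotentElem.range_eq_ker he]
    rfl
  by_cases ha : μ = a <;> by_cases hb : μ = b
  · have : End.eigenspace (a • e + b • (1 - e)) μ = ⊤ :=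
      Submodule.eq_top_iff'.2 fun x => (mem_eigenspace x).2 ⟨.inl ha, .inl hb⟩
    rw [this, finrank_top, if_pos ha, if_pos hb, LinearMap.finrank_range_add_finrank_ker]
  · have : End.eigenspace (a • e + b • (1 - e)) μ = LinearMap.range e := by
      ext x
      rw [mem_eigenspace, mem_range, or_iff_right hb, and_iff_right (Or.inl ha)]
    rw [this, if_pos ha, if_neg hb, add_zero]
  · have : End.eigenspace (a • e + b • (1 - e)) μ = LinearMap.ker e := by
      ext x
      rw [mem_eigenspace, or_iff_right ha, and_iff_left (Or.inl hb), LinearMap.mem_ker]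
    rw [this, if_neg ha, if_pos hb, zero_add]
  · have : End.eigenspace (a • e + b • (1 - e)) μ = ⊥ := by
      ext x
      rw [mem_eigenspace, or_iff_right ha, or_iff_right hb, Submodule.mem_bot]
      exact ⟨fun ⟨h, h'⟩ => by simpa [h] using h', fun h => by simp [h]⟩
    rw [this, finrank_bot, if_neg ha, if_neg hb]

end Idempotent

theorem continuous_multilinearMap_of_finiteDimensional {E F ι : Type*} [Finite ι]
    [NormedAddCommGroup E] [NormedSpace ℝ E] [FiniteDimensional ℝ E] [AddCommGroup F] [Module ℝ F]
    [TopologicalSpace F] [ContinuousAdd F] [ContinuousSMul ℝ F]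
    (f : MultilinearMap ℝ (fun _ : ι => E) F) : Continuous f := by
  classical
  cases nonempty_fintype ι
  let b := Module.finBasis ℝ E
  have expand (v : ι → E) :
      f v = ∑ I : ι → Fin (Module.finrank ℝ E),
        (∏ j, b.coord (I j) (v j)) • f fun j => b (I j) := by
    conv_lhs => rw [show v = fun j => ∑ i, b.coord i (v j) • b i from
      funext fun j => (b.sum_repr (v j)).symm]
    rw [f.map_sum]
    exact Finset.sum_congr rfl fun I _ => f.map_smul_univ (fun j => b.coord (I j) (v j)) _
  have continuous_coord (i) : Continuous (b.coord i) :=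
    LinearMap.continuous_of_finiteDimensional _
  rw [show (f : (ι → E) → F) = _ from funext expand]
  fun_prop

variable {n : ℕ}

section ExteriorAlgebra

/-- Exterior multiplication `a ↦ ⟪k, ·⟫ ∧ a` by the covector dual to `k`. -/
def wedge (p : ℕ) (k : Euc n) : AltForm n p →ₗ[ℂ] AltForm n (p + 1) where
  toFun a := ContinuousAlternatingMap.alternatizeUncurryFin ((innerSL ℝ k).smulRight a)
  map_add' a b := by
    rw [← ContinuousAlternatingMap.alternatizeUncurryFin_add]
    congr 1
    ext v w
    simp
  map_smul' c a := by
    rw [RingHom.id_apply, ← ContinuousAlternatingMap.alternatizeUncurryFin_smul]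
    congr 1
    ext v w
    simp only [ContinuousLinearMap.smulRight_apply, innerSL_apply_apply,
      smul_apply, ContinuousAlternatingMap.smul_apply]
    exact smul_comm _ _ _

/-- Interior multiplication `a ↦ k ⌟ a` as a complex linear map. -/
def contract (p : ℕ) (k : Euc n) : AltForm n (p + 1) →ₗ[ℂ] AltForm n p where
  toFun a := interior p a k
  map_add' a b := by simp only [map_add, add_apply]
  map_smul' _ _ := rfl

variable {p : ℕ}

theorem wedge_apply (k : Euc n) (a : AltForm n p) (v : Fin (p + 1) → Euc n) :
    wedge p k a v =
      ∑ i : Fin (p + 1), (-1 : ℤ) ^ (i : ℕ) • (inner ℝ k (v i) • a (i.removeNth v)) :=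
  ContinuousAlternatingMap.alternatizeUncurryFin_apply _ _

theorem contract_apply (k : Euc n) (a : AltForm n (p + 1)) (v : Fin p → Euc n) :
    contract p k a v = a (Matrix.vecCons k v) := rfl

theorem wedge_smul_left (r : ℝ) (k : Euc n) : wedge p (r • k) = (r : ℂ) • wedge p k := by
  ext a v
  simp only [wedge_apply, LinearMap.smul_apply, ContinuousAlternatingMap.smul_apply,
    real_inner_smul_left, mul_smul, Complex.coe_smul, Finset.smul_sum, smul_comm r]

theorem contract_smul_left (r : ℝ) (k : Euc n) : contract p (r • k) = (r : ℂ) • contract p k := by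
  ext a v
  exact congrArg (· v) ((interior p a).map_smul r k)

theorem wedge_wedge (k : Euc n) (a : AltForm n p) : wedge (p + 1) k (wedge p k a) = 0 := by
  have h :=
    ContinuousAlternatingMap.alternatizeUncurryFin_alternatizeUncurryFinCLM_comp_of_symmetric
      (𝕜 := ℝ) (f := (innerSL ℝ k).smulRight ((innerSL ℝ k).smulRight a)) fun x y => by
        ext w
        simp only [ContinuousLinearMap.smulRight_apply, coe_innerSL_apply, smul_apply,
          ContinuousAlternatingMap.coe_smul, Pi.smul_apply, Complex.real_smul]
        ring
  rw [← h]
  change ContinuousAlternatingMap.alternatizeUncurryFin _ = _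
  congr 1
  ext x w
  simp [wedge, ContinuousAlternatingMap.alternatizeUncurryFin_apply, Finset.mul_sum]

theorem contract_wedge_zero (k : Euc n) (a : AltForm n 0) :
    contract 0 k (wedge 0 k a) = ((‖k‖ ^ 2 : ℝ) : ℂ) • a := by
  ext v
  rw [contract_apply, wedge_apply]
  simp [Subsingleton.elim _ v]

theorem contract_wedge_add (k : Euc n) (a : AltForm n (p + 1)) :
    contract (p + 1) k (wedge (p + 1) k a) + wedge p k (contract p k a) =
      ((‖k‖ ^ 2 : ℝ) : ℂ) • a := by
  ext v
  have removeNth_zero : Fin.removeNth 0 (Matrix.vecCons k v) = v := by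
    funext j; simp [Fin.removeNth]
  have removeNth_succ (i : Fin (p + 1)) : Fin.removeNth i.succ (Matrix.vecCons k v) =
      Matrix.vecCons k (i.removeNth v) := by
    funext j
    refine Fin.cases ?_ (fun j => ?_) j <;> simp [Fin.removeNth]
  rw [ContinuousAlternatingMap.add_apply, contract_apply, wedge_apply, wedge_apply,
    Fin.sum_univ_succ]
  simp only [removeNth_zero, removeNth_succ, contract_apply]
  rw [add_assoc, ← Finset.sum_add_distrib, Finset.sum_eq_zero fun i _ => by simp [pow_succ]]
  simp

/-- The identification of `Λᵖ(ℝⁿ)* ⊗ ℂ` with the `ℂ`-valued functionals on `Λᵖ(ℝⁿ)`; continuity is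
automatic in finite dimensions. -/
def altFormEquiv (n p : ℕ) : AltForm n p ≃ₗ[ℂ] (⋀[ℝ]^p (Euc n) →ₗ[ℝ] ℂ) where
  toFun a := exteriorPower.alternatingMapLinearEquiv a.toAlternatingMap
  map_add' a b := by
    rw [← map_add]
    rfl
  map_smul' c a := by
    apply exteriorPower.linearMap_ext
    ext v
    simp
  invFun f :=
    { exteriorPower.alternatingMapLinearEquiv.symm f with
      cont := continuous_multilinearMap_of_finiteDimensional
        (exteriorPower.alternatingMapLinearEquiv.symm f).toMultilinearMap }
  left_inv a := by
    ext v
    exact congrArg (· v) (exteriorPower.alternatingMapLinearEquiv.symm_apply_apply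
      a.toAlternatingMap)
  right_inv f := exteriorPower.alternatingMapLinearEquiv.apply_symm_apply f

instance finiteDimensional_altForm (n p : ℕ) : FiniteDimensional ℂ (AltForm n p) :=
  .equiv (altFormEquiv n p).symm

theorem finrank_altForm (n p : ℕ) : Module.finrank ℂ (AltForm n p) = n.choose p := by
  rw [(altFormEquiv n p).finrank_eq, Module.finrank_linearMap, exteriorPower.finrank_eq,
    finrank_euclideanSpace_fin, Module.finrank_self, mul_one]

end ExteriorAlgebra

section Symbol

variable {p : ℕ} {u : Euc n}

theorem wedge_contract_wedge (hu : ‖u‖ = 1) (a : AltForm n p) :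
    wedge p u (contract p u (wedge p u a)) = wedge p u a := by
  have cartan := contract_wedge_add u (wedge p u a)
  rwa [wedge_wedge, map_zero, zero_add, hu, one_pow, Complex.ofReal_one, one_smul] at cartan

theorem isIdempotentElem_wedge_contract (hu : ‖u‖ = 1) :
    IsIdempotentElem (M := Module.End ℂ (AltForm n (p + 1))) (wedge p u ∘ₗ contract p u) :=
  LinearMap.ext fun a => wedge_contract_wedge hu (contract p u a)

theorem contract_wedge_eq_one_sub (hu : ‖u‖ = 1) :
    contract (p + 1) u ∘ₗ wedge (p + 1) u =
      (1 - wedge p u ∘ₗ contract p u : Module.End ℂ (AltForm n (p + 1))) := by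
  refine LinearMap.ext fun a => eq_sub_of_add_eq ?_
  simpa [hu] using contract_wedge_add u a

theorem range_wedge_contract (hu : ‖u‖ = 1) :
    LinearMap.range (wedge p u ∘ₗ contract p u) = LinearMap.range (wedge p u) :=
  le_antisymm (LinearMap.range_comp_le_range _ _) <| by
    rintro _ ⟨a, rfl⟩
    exact ⟨wedge p u a, wedge_contract_wedge hu a⟩

theorem wedge_zero_injective (hu : ‖u‖ = 1) : Function.Injective (wedge 0 u) :=
  Function.LeftInverse.injective (g := contract 0 u) fun a => by
    simpa [hu] using contract_wedge_zero u a

theorem ker_wedge_succ (hu : ‖u‖ = 1) :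
    LinearMap.ker (wedge (p + 1) u) = LinearMap.range (wedge p u) := by
  apply le_antisymm
  · intro a ha
    refine ⟨contract p u a, ?_⟩
    simpa [hu, LinearMap.mem_ker.1 ha] using contract_wedge_add u a
  · rintro _ ⟨a, rfl⟩
    exact wedge_wedge u a

theorem finrank_range_wedge (hn : n ≠ 0) (hu : ‖u‖ = 1) (p : ℕ) :
    Module.finrank ℂ (LinearMap.range (wedge p u)) = (n - 1).choose p := by
  induction p with
  | zero =>
    have := LinearMap.finrank_range_of_inj (wedge_zero_injective hu)
    rw [this, finrank_altForm, Nat.choose_zero_right, Nat.choose_zero_right]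
  | succ p ih =>
    have := LinearMap.finrank_range_add_finrank_ker (wedge (p + 1) u)
    rw [ker_wedge_succ hu, ih, finrank_altForm,
      Nat.choose_succ_right _ _ (Nat.pos_of_ne_zero hn), add_comm] at this
    exact add_left_cancel this

/-- The principal symbol of `α d δ + β δ d` on `(p+1)`-forms at the covector `k`. -/
def symbol (α β : ℝ) (p : ℕ) (k : Euc n) : Module.End ℂ (AltForm n (p + 1)) :=
  (α : ℂ) • (wedge p k ∘ₗ contract p k) + (β : ℂ) • (contract (p + 1) k ∘ₗ wedge (p + 1) k)

theorem symbol_smul_of_norm_eq_one (hu : ‖u‖ = 1) (α β r : ℝ) :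
    symbol α β p (r • u) = ((α * r ^ 2 : ℝ) : ℂ) • (wedge p u ∘ₗ contract p u) +
      ((β * r ^ 2 : ℝ) : ℂ) • (1 - wedge p u ∘ₗ contract p u) := by
  rw [symbol, ← contract_wedge_eq_one_sub hu]
  simp only [wedge_smul_left, contract_smul_left, LinearMap.comp_smul, LinearMap.smul_comp,
    smul_smul]
  push_cast
  simp only [pow_two]

open scoped Classical in
theorem finrank_eigenspace_symbol (hn : n ≠ 0) (α β : ℝ) (p : ℕ) (k : Euc n) (μ : ℂ) :
    Module.finrank ℂ ((symbol α β p k).eigenspace μ) =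
      (if μ = ((α * ‖k‖ ^ 2 : ℝ) : ℂ) then (n - 1).choose p else 0) +
      (if μ = ((β * ‖k‖ ^ 2 : ℝ) : ℂ) then (n - 1).choose (p + 1) else 0) := by
  have : NeZero n := ⟨hn⟩
  obtain ⟨u, hu, hk⟩ : ∃ u : Euc n, ‖u‖ = 1 ∧ k = ‖k‖ • u := by
    rcases eq_or_ne k 0 with rfl | hk
    · exact ⟨stdVec 0, by simp, by simp⟩
    · exact ⟨‖k‖⁻¹ • k, norm_smul_inv_norm hk, by simp [smul_smul, hk]⟩
  have finrank_range : Module.finrank ℂ (LinearMap.range (wedge p u ∘ₗ contract p u)) =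
      (n - 1).choose p := by
    rw [range_wedge_contract hu, finrank_range_wedge hn hu]
  have finrank_ker : Module.finrank ℂ (LinearMap.ker (wedge p u ∘ₗ contract p u)) =
      (n - 1).choose (p + 1) := by
    have := LinearMap.finrank_range_add_finrank_ker (wedge p u ∘ₗ contract p u)
    rw [finrank_range, finrank_altForm,
      Nat.choose_succ_right _ _ (Nat.pos_of_ne_zero hn)] at this
    exact add_left_cancel this
  conv_lhs => rw [hk]
  rw [symbol_smul_of_norm_eq_one hu,
    finrank_eigenspace_of_isIdempotentElem (isIdempotentElem_wedge_contract hu),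
    finrank_range, finrank_ker]

end Symbol

section Dilation

variable {𝕜 E R : Type*} [NormedField 𝕜] [NormedAddCommGroup E] [NormedSpace 𝕜 E]

/-- The family of dilates `x ↦ N (c⁻¹ x)` of a function `N` on a normed space. -/
def dilate (N : E → R) (c : 𝕜) : E → R := fun x => N (c⁻¹ • x)

-- Evaluating a relation at `c • s`, with `c` of least norm in its support, isolates the coefficient
-- of `c`.
theorem linearIndepOn_dilate [Ring R] [NoZeroDivisors R] {N : E → R} {s : E} (hs : s ≠ 0)
    (hNs : N s ≠ 0) (hmin : ∀ x ≠ 0, x ≠ s → N x ≠ 0 → ‖s‖ < ‖x‖) :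
    LinearIndepOn R (dilate N : 𝕜 → E → R) {0}ᶜ := by
  refine linearIndepOn_iff.2 fun l hl hrel => by_contra fun hne => ?_
  obtain ⟨c, hc, hcmin⟩ := l.support.exists_min_image norm (Finsupp.support_nonempty_iff.2 hne)
  have hc0 : c ≠ 0 := hl hc
  have other_terms (b : 𝕜) (hb : b ∈ l.support) (hbc : b ≠ c) : N (b⁻¹ • c • s) = 0 := by
    have hb0 : b ≠ 0 := hl hb
    by_contra hN
    have hlt : ‖s‖ < ‖b⁻¹ • c • s‖ := by
      refine hmin _ (by simp [hb0, hc0, hs]) (fun h => hbc ?_) hN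
      have : (c - b) • s = 0 := by rw [sub_smul, sub_eq_zero, ← inv_smul_eq_iff₀ hb0, h]
      exact (sub_eq_zero.1 ((smul_eq_zero.1 this).resolve_right hs)).symm
    rw [norm_smul, norm_smul, norm_inv, lt_inv_mul_iff₀ (norm_pos_iff.2 hb0)] at hlt
    exact (lt_of_mul_lt_mul_right hlt (norm_nonneg s)).not_ge (hcmin b hb)
  have eval := congrFun hrel (c • s)
  simp only [Finsupp.linearCombination_apply, Finsupp.sum, Finset.sum_apply, Pi.smul_apply,
    dilate, smul_eq_mul, Pi.zero_apply] at eval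
  rw [Finset.sum_eq_single_of_mem c hc fun b hb hbc => by rw [other_terms b hb hbc, mul_zero],
    inv_smul_smul₀ hc0] at eval
  exact (mul_ne_zero (Finsupp.mem_support_iff.1 hc) hNs) eval

end Dilation

section ReciprocalLattice

open Module Real

/-- The bilinear form `⟪ξ, v⟫ / 2π`, whose integrality on a lattice makes `x ↦ exp (i ⟪ξ, x⟫)`
periodic. -/
def phaseForm (n : ℕ) : LinearMap.BilinForm ℝ (Euc n) := (2 * π)⁻¹ • innerₗ (Euc n)

/-- The reciprocal lattice: the vectors `ξ` with `⟪ξ, v⟫ ∈ 2πℤ` for all `v ∈ Λ`. -/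
def reciprocalLattice (Λ : Submodule ℤ (Euc n)) : Submodule ℤ (Euc n) :=
  (phaseForm n).dualSubmodule Λ

theorem phaseForm_apply (ξ v : Euc n) : phaseForm n ξ v = (2 * π)⁻¹ * inner ℝ ξ v := rfl

theorem phaseForm_isSymm : (phaseForm n).IsSymm :=
  ⟨fun ξ v => by simp only [phaseForm_apply, real_inner_comm]⟩

theorem phaseForm_nondegenerate : (phaseForm n).Nondegenerate := by
  refine (LinearMap.IsRefl.nondegenerate_iff_separatingLeft phaseForm_isSymm.isRefl).2
    fun ξ hξ => ?_
  have := hξ ξ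
  simpa [phaseForm_apply, pi_ne_zero] using this

variable {Λ : Submodule ℤ (Euc n)} {ξ : Euc n}

theorem mem_reciprocalLattice :
    ξ ∈ reciprocalLattice Λ ↔ ∀ v ∈ Λ, ∃ m : ℤ, inner ℝ ξ v = m * (2 * π) := by
  refine forall₂_congr fun v _ => Submodule.mem_one.trans (exists_congr fun m => ?_)
  rw [phaseForm_apply, algebraMap_int_eq, eq_intCast, eq_inv_mul_iff_mul_eq₀ (by positivity),
    mul_comm, eq_comm]

variable (Λ) [DiscreteTopology Λ] [IsZLattice ℝ Λ]

theorem exists_reciprocalLattice_eq_span : ∃ b : Basis (Free.ChooseBasisIndex ℤ Λ) ℝ (Euc n),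
    reciprocalLattice Λ = Submodule.span ℤ (Set.range b) := by
  classical
  refine ⟨(phaseForm n).dualBasis phaseForm_nondegenerate
    ((Free.chooseBasis ℤ Λ).ofZLatticeBasis ℝ Λ), ?_⟩
  rw [← LinearMap.BilinForm.dualSubmodule_span_of_basis, Basis.ofZLatticeBasis_span]
  rfl

instance discreteTopology_reciprocalLattice : DiscreteTopology (reciprocalLattice Λ) := by
  obtain ⟨b, hb⟩ := exists_reciprocalLattice_eq_span Λ
  rw [hb]
  infer_instance

instance isZLattice_reciprocalLattice : IsZLattice ℝ (reciprocalLattice Λ) := by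
  obtain ⟨b, hb⟩ := exists_reciprocalLattice_eq_span Λ
  exact ⟨by rw [hb, ZSpan.span_top]⟩

theorem reciprocalLattice_reciprocalLattice :
    reciprocalLattice (reciprocalLattice Λ) = Λ := by
  have h := LinearMap.BilinForm.dualSubmodule_dualSubmodule_of_basis (R := ℤ) (phaseForm n)
    phaseForm_nondegenerate phaseForm_isSymm ((Free.chooseBasis ℤ Λ).ofZLatticeBasis ℝ Λ)
  rwa [Basis.ofZLatticeBasis_span] at h

end ReciprocalLattice

section LengthCount

/-- The number of vectors `ξ` of a lattice `L` with `‖ξ‖² = μ`, for a complex number `μ`. -/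
def lengthCount (L : Submodule ℤ (Euc n)) (μ : ℂ) : ℕ :=
  {ξ : Euc n | ξ ∈ L ∧ ((‖ξ‖ ^ 2 : ℝ) : ℂ) = μ}.ncard

variable (L : Submodule ℤ (Euc n)) [DiscreteTopology L]

theorem finite_norm_le (R : ℝ) : {ξ : Euc n | ξ ∈ L ∧ ‖ξ‖ ≤ R}.Finite := by
  have : DiscreteTopology L.toAddSubgroup := ‹DiscreteTopology L›
  refine (Metric.finite_isBounded_inter_isClosed DiscreteTopology.isDiscrete
    (Metric.isBounded_closedBall (x := (0 : Euc n)) (r := R))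
    (AddSubgroup.isClosed_of_discrete (H := L.toAddSubgroup))).subset ?_
  exact fun ξ hξ => ⟨mem_closedBall_zero_iff.2 hξ.2, hξ.1⟩

theorem finite_normSq_eq (μ : ℂ) :
    {ξ : Euc n | ξ ∈ L ∧ ((‖ξ‖ ^ 2 : ℝ) : ℂ) = μ}.Finite := by
  refine (finite_norm_le L (√‖μ‖)).subset fun ξ ⟨hξ, hμ⟩ => ⟨hξ, ?_⟩
  rw [← hμ, Complex.norm_real, Real.norm_of_nonneg (sq_nonneg _), Real.sqrt_sq (norm_nonneg ξ)]

theorem exists_shortest [IsZLattice ℝ L] (hn : n ≠ 0) :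
    ∃ ξ ∈ L, ξ ≠ 0 ∧ ∀ η ∈ L, η ≠ 0 → ‖ξ‖ ≤ ‖η‖ := by
  have : NeZero n := ⟨hn⟩
  obtain ⟨η, hηL, hη⟩ : ∃ η ∈ L, η ≠ 0 := by
    refine L.exists_mem_ne_zero_of_ne_bot fun hL => ?_
    have := IsZLattice.span_top (K := ℝ) (L := L)
    rw [hL, Submodule.bot_coe, Submodule.span_zero_singleton] at this
    exact bot_ne_top this
  obtain ⟨ξ, ⟨⟨hξL, hξη⟩, hξ⟩, hmin⟩ := ((finite_norm_le L ‖η‖).sdiff (t := {0})).exists_minimalFor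
    norm _ ⟨η, ⟨hηL, le_rfl⟩, hη⟩
  refine ⟨ξ, hξL, hξ, fun ζ hζL hζ => ?_⟩
  rcases le_total ‖ζ‖ ‖ξ‖ with h | h
  · exact hmin ⟨⟨hζL, h.trans hξη⟩, hζ⟩ h
  · exact h

theorem linearIndepOn_dilate_lengthCount [IsZLattice ℝ L] (hn : n ≠ 0) :
    LinearIndepOn ℤ (dilate (fun μ => (lengthCount L μ : ℤ)) : ℝ → ℂ → ℤ) {0}ᶜ := by
  obtain ⟨ξ, hξL, hξ, hmin⟩ := exists_shortest L hn
  refine linearIndepOn_dilate (s := ((‖ξ‖ ^ 2 : ℝ) : ℂ)) (by simpa using hξ) ?_ ?_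
  · exact Nat.cast_ne_zero.2 (Set.ncard_ne_zero_of_mem (a := ξ) ⟨hξL, rfl⟩ (finite_normSq_eq L _))
  · intro μ hμ hne hN
    obtain ⟨η, hηL, rfl⟩ := Set.nonempty_of_ncard_ne_zero (Nat.cast_ne_zero.1 hN)
    have hle : ‖ξ‖ ^ 2 ≤ ‖η‖ ^ 2 := by
      gcongr
      exact hmin η hηL (by simpa using hμ)
    simp only [Complex.norm_real, Real.norm_of_nonneg (sq_nonneg _)]
    exact hle.lt_of_ne fun h => hne (by rw [h])

end LengthCount

section Wave

open Complex

/-- The plane wave `x ↦ exp (i ⟪ξ, x⟫)`. -/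
def wave (ξ x : Euc n) : ℂ := exp (inner ℝ ξ x * I)

theorem wave_zero_left (x : Euc n) : wave 0 x = 1 := by
  rw [wave, inner_zero_left, ofReal_zero, zero_mul, exp_zero]

theorem wave_add_left (ξ η x : Euc n) : wave (ξ + η) x = wave ξ x * wave η x := by
  rw [wave, wave, wave, inner_add_left, ofReal_add, add_mul, exp_add]

theorem wave_neg_left (ξ x : Euc n) : wave (-ξ) x = starRingEnd ℂ (wave ξ x) := by
  rw [wave, wave, ← exp_conj, inner_neg_left, map_mul, conj_ofReal, conj_I, ofReal_neg, neg_mul,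
    mul_neg]

theorem wave_neg_mul_wave (ξ x : Euc n) : wave (-ξ) x * wave ξ x = 1 := by
  rw [← wave_add_left, neg_add_cancel, wave_zero_left]

theorem contDiff_wave (ξ : Euc n) : ContDiff ℝ (⊤ : ℕ∞) (wave ξ) :=
  ((ofRealCLM.contDiff.comp (contDiff_const.inner ℝ contDiff_id)).mul contDiff_const).cexp

theorem fderiv_wave (ξ x v : Euc n) :
    fderiv ℝ (wave ξ) x v = (inner ℝ ξ v * I) * wave ξ x := by
  have h : HasFDerivAt (wave ξ) _ x :=
    ((ofRealCLM.hasFDerivAt.comp x (innerSL ℝ ξ).hasFDerivAt).mul_const I).cexp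
  rw [h.fderiv]
  simp only [coe_innerSL_apply, Function.comp_apply, ofRealCLM_apply, smul_apply,
    ContinuousLinearMap.comp_apply, smul_eq_mul, wave]
  ring

variable {Λ : Submodule ℤ (Euc n)} {ξ : Euc n}

theorem wave_eq_wave_iff {x y : Euc n} :
    wave ξ x = wave ξ y ↔ ∃ m : ℤ, inner ℝ ξ (x - y) = m * (2 * Real.pi) := by
  rw [wave, wave, exp_eq_exp_iff_exists_int]
  refine exists_congr fun m => ?_
  rw [inner_sub_right, sub_eq_iff_eq_add', ← mul_assoc, ← mul_assoc, ← add_mul,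
    mul_left_inj' I_ne_zero, ← mul_assoc]
  exact_mod_cast Iff.rfl

theorem wave_add_lattice (hξ : ξ ∈ reciprocalLattice Λ) (x : Euc n) {v : Euc n} (hv : v ∈ Λ) :
    wave ξ (x + v) = wave ξ x :=
  wave_eq_wave_iff.2 <| by simpa using mem_reciprocalLattice.1 hξ v hv

end Wave

section TorusMeasure

open MeasureTheory
open scoped Pointwise

variable (Λ : Submodule ℤ (Euc n)) [DiscreteTopology Λ] [IsZLattice ℝ Λ]

theorem isAddFundamentalDomain_fundDomain : IsAddFundamentalDomain Λ (fundDomain Λ) :=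
  ZLattice.isAddFundamentalDomain (Module.Free.chooseBasis ℤ Λ) volume

theorem isBounded_fundDomain : Bornology.IsBounded (fundDomain Λ) :=
  ZSpan.fundamentalDomain_isBounded _

theorem exists_mem_fundDomain (t : Torus Λ) : ∃ x ∈ fundDomain Λ, proj Λ x = t := by
  obtain ⟨x, rfl⟩ := QuotientAddGroup.mk_surjective t
  let b := (Module.Free.chooseBasis ℤ Λ).ofZLatticeBasis ℝ Λ
  have floor_mem : (ZSpan.floor b x : Euc n) ∈ Λ :=
    ((Module.Free.chooseBasis ℤ Λ).ofZLatticeBasis_span ℝ Λ).le (ZSpan.floor b x).2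
  refine ⟨ZSpan.fract b x, ZSpan.fract_mem_fundamentalDomain b x, ?_⟩
  rw [ZSpan.fract_apply, sub_eq_add_neg]
  exact proj_add x (neg_mem floor_mem)

instance compactSpace_torus : CompactSpace (Torus Λ) := by
  refine ⟨((isBounded_fundDomain Λ).isCompact_closure.image
    (QuotientAddGroup.continuous_mk (N := Λ.toAddSubgroup))).of_isClosed_subset isClosed_univ ?_⟩
  intro t _
  obtain ⟨x, hx, rfl⟩ := exists_mem_fundDomain Λ t
  exact ⟨x, subset_closure hx, rfl⟩

instance isFiniteMeasure_torusMeasure : IsFiniteMeasure (torusMeasure Λ) := by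
  have : IsFiniteMeasure (volume.restrict (fundDomain Λ)) :=
    isFiniteMeasure_restrict.2 (isBounded_fundDomain Λ).measure_lt_top.ne
  exact Measure.isFiniteMeasure_map _ _

instance isOpenPosMeasure_torusMeasure : (torusMeasure Λ).IsOpenPosMeasure := by
  refine ⟨fun U hU hne hzero => ?_⟩
  have hVopen : IsOpen (proj Λ ⁻¹' U) := hU.preimage QuotientAddGroup.continuous_mk
  rw [torusMeasure, Measure.map_apply QuotientAddGroup.measurable_coe hU.measurableSet,
    Measure.restrict_apply hVopen.measurableSet] at hzero
  have : VAddInvariantMeasure Λ (Euc n) volume :=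
    inferInstanceAs <| VAddInvariantMeasure Λ.toAddSubgroup (Euc n) volume
  have hVinvariant (v : Λ) : v +ᵥ (proj Λ ⁻¹' U) = proj Λ ⁻¹' U := by
    ext x
    rw [Set.mem_vadd_set_iff_neg_vadd_mem, Set.mem_preimage, Set.mem_preimage,
      Submodule.vadd_def, vadd_eq_add, add_comm, proj_add x (-v).2]
  exact hVopen.measure_ne_zero volume (hne.preimage QuotientAddGroup.mk_surjective)
    ((isAddFundamentalDomain_fundDomain Λ).measure_zero_of_invariant _ hVinvariant hzero)

theorem integral_torusMeasure {E : Type*} [NormedAddCommGroup E] [NormedSpace ℝ E]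
    (f : C(Torus Λ, E)) :
    ∫ t, f t ∂(torusMeasure Λ) = ∫ x in fundDomain Λ, f (proj Λ x) :=
  integral_map QuotientAddGroup.measurable_coe.aemeasurable
    f.continuous.stronglyMeasurable.aestronglyMeasurable

end TorusMeasure

section Characters

open ContinuousMap

variable {Λ : Submodule ℤ (Euc n)}

/-- The continuous function on the torus induced by a continuous `Λ`-periodic function. -/
def torusLift {E : Type*} [TopologicalSpace E] (f : Euc n → E) (hf : Continuous f)
    (hper : ∀ x, ∀ v ∈ Λ, f (x + v) = f x) : C(Torus Λ, E) where
  toFun := Quotient.lift f fun a b h => by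
    simpa using (hper a _ (QuotientAddGroup.leftRel_apply.mp h)).symm
  continuous_toFun := hf.quotient_lift _

/-- The character of the torus given by a plane wave with wave vector in the reciprocal lattice. -/
def torusChar (ξ : reciprocalLattice Λ) : C(Torus Λ, ℂ) :=
  torusLift (wave ξ) (contDiff_wave _).continuous fun x _ hv => wave_add_lattice ξ.2 x hv

/-- The star subalgebra of continuous functions on the torus generated by the characters. -/
def charSubalgebra (Λ : Submodule ℤ (Euc n)) : StarSubalgebra ℂ C(Torus Λ, ℂ) where
  toSubalgebra := Algebra.adjoin ℂ (Set.range torusChar)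
  star_mem' := by
    change Algebra.adjoin ℂ (Set.range torusChar) ≤ star (Algebra.adjoin ℂ (Set.range torusChar))
    refine Algebra.adjoin_le ?_
    rintro _ ⟨ξ, rfl⟩
    refine Algebra.subset_adjoin ⟨-ξ, ?_⟩
    ext ⟨x⟩
    exact wave_neg_left _ x

theorem charSubalgebra_toSubmodule :
    Subalgebra.toSubmodule (charSubalgebra Λ).toSubalgebra =
      Submodule.span ℂ (Set.range torusChar) := by
  apply Algebra.adjoin_eq_span_of_subset
  refine .trans (fun f => Submonoid.closure_induction (fun _ => id) ⟨0, ?_⟩ ?_)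
    Submodule.subset_span
  · ext ⟨x⟩
    exact wave_zero_left x
  · rintro _ _ _ _ ⟨ξ, rfl⟩ ⟨η, rfl⟩
    refine ⟨ξ + η, ?_⟩
    ext ⟨x⟩
    exact wave_add_left _ _ x

variable [DiscreteTopology Λ] [IsZLattice ℝ Λ]

theorem charSubalgebra_separatesPoints : (charSubalgebra Λ).SeparatesPoints := by
  rintro ⟨x⟩ ⟨y⟩ hxy
  by_contra! h
  refine hxy (QuotientAddGroup.eq.2 ?_)
  rw [Submodule.mem_toAddSubgroup, ← reciprocalLattice_reciprocalLattice Λ, neg_add_eq_sub,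
    mem_reciprocalLattice]
  intro ξ hξ
  rw [real_inner_comm]
  exact wave_eq_wave_iff.1
    (h _ ⟨torusChar ⟨ξ, hξ⟩, Algebra.subset_adjoin ⟨_, rfl⟩, rfl⟩).symm

theorem topologicalClosure_span_torusChar :
    (Submodule.span ℂ (Set.range (torusChar (Λ := Λ)))).topologicalClosure = ⊤ := by
  rw [← charSubalgebra_toSubmodule]
  exact congrArg (fun A => Subalgebra.toSubmodule (StarSubalgebra.toSubalgebra A))
    (starSubalgebra_topologicalClosure_eq_top_of_separatesPoints _ charSubalgebra_separatesPoints)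

theorem eq_zero_of_forall_integral_torusChar_eq_zero {f : C(Torus Λ, ℂ)}
    (h : ∀ ξ, ∫ t, starRingEnd ℂ (torusChar ξ t) * f t ∂(torusMeasure Λ) = 0) : f = 0 := by
  let toL2 : C(Torus Λ, ℂ) →L[ℂ] MeasureTheory.Lp ℂ 2 (torusMeasure Λ) :=
    ContinuousMap.toLp 2 (torusMeasure Λ) ℂ
  let Φ : C(Torus Λ, ℂ) →L[ℂ] ℂ := (innerSL ℂ (toL2 f)).comp toL2
  have span_le : Submodule.span ℂ (Set.range torusChar) ≤ LinearMap.ker Φ.toLinearMap := by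
    rw [Submodule.span_le]
    rintro _ ⟨ξ, rfl⟩
    have inner_char : inner ℂ (toL2 (torusChar ξ)) (toL2 f) = 0 :=
      (MeasureTheory.ContinuousMap.inner_toLp (torusMeasure Λ) _ _).trans
        (by simpa only [mul_comm] using h ξ)
    exact inner_eq_zero_symm.1 inner_char
  have ker_eq_top : LinearMap.ker Φ.toLinearMap = ⊤ := by
    rw [← top_le_iff, ← topologicalClosure_span_torusChar]
    exact Submodule.topologicalClosure_minimal _ span_le Φ.isClosed_ker
  have self_inner : inner ℂ (toL2 f) (toL2 f) = 0 :=
    LinearMap.mem_ker.1 (ker_eq_top ▸ Submodule.mem_top : f ∈ LinearMap.ker Φ.toLinearMap)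
  exact ContinuousMap.toLp_injective _ ((inner_self_eq_zero.1 self_inner).trans (map_zero _).symm)

end Characters

section FourierCoeff

open MeasureTheory Complex

variable {Λ : Submodule ℤ (Euc n)} [DiscreteTopology Λ] [IsZLattice ℝ Λ] {ξ η : Euc n}
  {E G : Type*} [NormedAddCommGroup E] [NormedAddCommGroup G] {f : Euc n → E}

theorem integrableOn_fundDomain_of_continuous (hf : Continuous f) :
    IntegrableOn f (fundDomain Λ) :=
  (hf.continuousOn.integrableOn_compact (isBounded_fundDomain Λ).isCompact_closure).mono_set
    subset_closure

variable [NormedSpace ℂ E] [NormedSpace ℂ G]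

theorem integrableOn_wave_smul (hf : Continuous f) (ξ : Euc n) :
    IntegrableOn (fun x => wave ξ x • f x) (fundDomain Λ) :=
  integrableOn_fundDomain_of_continuous ((contDiff_wave ξ).continuous.smul hf)

theorem setIntegral_wave (hη : η ∈ reciprocalLattice Λ) (hη0 : η ≠ 0) :
    ∫ x in fundDomain Λ, wave η x = 0 := by
  have total := setIntegral_fderiv_eq_zero (contDiff_wave η) (fun x _ => wave_add_lattice hη x) η
  simp only [fderiv_wave] at total
  rw [integral_const_mul] at total
  exact (mul_eq_zero.1 total).resolve_left (by simp [hη0])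

variable [NormedSpace ℝ E] [NormedSpace ℝ G]

variable (Λ) in
/-- The Fourier coefficient at `ξ` of a vector-valued `Λ`-periodic function on `ℝⁿ`. It is not
normalized by the volume of the torus. -/
def fourierCoeff (ξ : Euc n) (f : Euc n → E) : E := ∫ x in fundDomain Λ, wave (-ξ) x • f x

theorem fourierCoeff_add {g : Euc n → E} (hf : Continuous f) (hg : Continuous g) :
    fourierCoeff Λ ξ (f + g) = fourierCoeff Λ ξ f + fourierCoeff Λ ξ g := by
  simp only [fourierCoeff, Pi.add_apply, smul_add]
  exact integral_add (integrableOn_wave_smul hf _) (integrableOn_wave_smul hg _)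

open scoped Classical in
theorem fourierCoeff_wave_smul [CompleteSpace E] (hξ : ξ ∈ reciprocalLattice Λ)
    (hη : η ∈ reciprocalLattice Λ) (a : E) :
    fourierCoeff Λ ξ (fun x => wave η x • a) =
      if ξ = η then (ZLattice.covolume Λ : ℂ) • a else 0 := by
  simp only [fourierCoeff, smul_smul]
  rw [integral_smul_const]
  split_ifs with h
  · subst h
    simp only [wave_neg_mul_wave]
    rw [ZLattice.covolume_eq_measure_fundamentalDomain Λ volume
      (isAddFundamentalDomain_fundDomain Λ)]
    simp
  · simp only [← wave_add_left]
    rw [setIntegral_wave (add_mem (neg_mem hξ) hη) fun h0 => h (neg_add_eq_zero.1 h0), zero_smul]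

theorem fourierCoeff_comp [CompleteSpace E] [CompleteSpace G] (L : E →L[ℝ] G)
    (hL : ∀ (c : ℂ) (a : E), L (c • a) = c • L a) (hf : Continuous f) :
    fourierCoeff Λ ξ (fun x => L (f x)) = L (fourierCoeff Λ ξ f) := by
  simp only [fourierCoeff, ← hL]
  exact L.integral_comp_comm (integrableOn_wave_smul hf _)

variable [IsScalarTower ℝ ℂ E]

theorem fourierCoeff_smul (c : ℂ) : fourierCoeff Λ ξ (c • f) = c • fourierCoeff Λ ξ f := by
  simp only [fourierCoeff, Pi.smul_apply, smul_comm _ c]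
  exact integral_smul c _

variable [CompleteSpace E]

theorem setIntegral_fderiv_eq_zero_of_periodic (hf : ContDiff ℝ (⊤ : ℕ∞) f)
    (hper : ∀ x, ∀ v ∈ Λ, f (x + v) = f x) (v : Euc n) :
    ∫ x in fundDomain Λ, fderiv ℝ f x v = 0 := by
  have hint : IntegrableOn (fun x => fderiv ℝ f x v) (fundDomain Λ) :=
    integrableOn_fundDomain_of_continuous
      ((hf.continuous_fderiv (by simp)).clm_apply continuous_const)
  refine SeparatingDual.eq_zero_of_forall_dual_eq_zero (R := ℂ) fun φ => ?_
  rw [← φ.integral_comp_comm hint]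
  have fderiv_comp (x) : fderiv ℝ (fun y => φ (f y)) x v = φ (fderiv ℝ f x v) :=
    congrArg (· v) ((φ.restrictScalars ℝ).hasFDerivAt.comp x
      (hf.differentiable (by simp) x).hasFDerivAt).fderiv
  simp only [← fderiv_comp]
  exact setIntegral_fderiv_eq_zero ((φ.restrictScalars ℝ).contDiff.comp hf)
    (fun x w hw => congrArg φ (hper x w hw)) v

theorem fourierCoeff_fderiv_apply (hξ : ξ ∈ reciprocalLattice Λ) (hf : ContDiff ℝ (⊤ : ℕ∞) f)
    (hper : ∀ x, ∀ v ∈ Λ, f (x + v) = f x) (v : Euc n) :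
    fourierCoeff Λ ξ (fun x => fderiv ℝ f x v) = (inner ℝ ξ v * I) • fourierCoeff Λ ξ f := by
  have product_rule (x) : fderiv ℝ (wave (-ξ) • f) x v =
      wave (-ξ) x • fderiv ℝ f x v - (inner ℝ ξ v * I) • wave (-ξ) x • f x := by
    rw [fderiv_smul ((contDiff_wave (-ξ)).differentiable (by simp) x)
      (hf.differentiable (by simp) x)]
    simp [fderiv_wave, smul_smul, sub_eq_add_neg]
  have total := setIntegral_fderiv_eq_zero_of_periodic (Λ := Λ) ((contDiff_wave (-ξ)).smul hf)
    (fun x w hw => congrArg₂ (· • ·) (wave_add_lattice (neg_mem hξ) x hw) (hper x w hw)) v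
  have hint : IntegrableOn (fun x => wave (-ξ) x • fderiv ℝ f x v) (fundDomain Λ) :=
    integrableOn_wave_smul ((hf.continuous_fderiv (by simp)).clm_apply continuous_const) _
  have hint' := (integrableOn_wave_smul (Λ := Λ) hf.continuous (-ξ)).fun_smul (inner ℝ ξ v * I)
  simp only [product_rule] at total
  rw [integral_sub hint hint', integral_smul] at total
  exact sub_eq_zero.1 total

theorem fourierCoeff_fderiv (hξ : ξ ∈ reciprocalLattice Λ) (hf : ContDiff ℝ (⊤ : ℕ∞) f)
    (hper : ∀ x, ∀ v ∈ Λ, f (x + v) = f x) :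
    fourierCoeff Λ ξ (fderiv ℝ f) = (innerSL ℝ ξ).smulRight (I • fourierCoeff Λ ξ f) := by
  ext v
  have eval := fourierCoeff_comp (Λ := Λ) (ξ := ξ) (ContinuousLinearMap.apply ℝ E v)
    (fun _ _ => rfl) (hf.continuous_fderiv (by simp))
  refine eval.symm.trans ((fourierCoeff_fderiv_apply hξ hf hper v).trans ?_)
  rw [mul_smul, ContinuousLinearMap.smulRight_apply, innerSL_apply_apply]
  exact algebraMap_smul ℂ (inner ℝ ξ v) _

theorem eq_zero_of_fourierCoeff_eq_zero (hf : Continuous f)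
    (hper : ∀ x, ∀ v ∈ Λ, f (x + v) = f x) (h : ∀ ξ ∈ reciprocalLattice Λ, fourierCoeff Λ ξ f = 0) :
    f = 0 := by
  refine funext fun x => SeparatingDual.eq_zero_of_forall_dual_eq_zero (R := ℂ) fun φ => ?_
  let g : C(Torus Λ, ℂ) := torusLift (fun x => φ (f x)) (φ.continuous.comp hf)
    fun x v hv => by rw [hper x v hv]
  have g_eq_zero : g = 0 := eq_zero_of_forall_integral_torusChar_eq_zero fun ξ => by
    refine (integral_torusMeasure Λ (star (torusChar ξ) * g)).trans ?_
    have coeff := fourierCoeff_comp (Λ := Λ) (ξ := ξ) (φ.restrictScalars ℝ) φ.map_smul hf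
    rw [h ξ ξ.2, map_zero] at coeff
    simpa only [fourierCoeff, wave_neg_left] using! coeff
  exact congrArg (· (proj Λ x)) g_eq_zero

end FourierCoeff

section FormCoeff

theorem continuous_fderiv_pull {Λ : Submodule ℤ (Euc n)} {p : ℕ} (ω : SmoothForm Λ p) :
    Continuous (fderiv ℝ (pull ω)) :=
  (contDiff_pull ω).continuous_fderiv (by simp)

variable {Λ : Submodule ℤ (Euc n)} [DiscreteTopology Λ] [IsZLattice ℝ Λ] {p : ℕ} {ξ η : Euc n}

variable (Λ) in
/-- The Fourier coefficient at `ξ` of the pullback to `ℝⁿ` of a form on the torus. -/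
def formCoeff (p : ℕ) (ξ : Euc n) : SmoothForm Λ p →ₗ[ℂ] AltForm n p where
  toFun ω := fourierCoeff Λ ξ (pull ω)
  map_add' ω η := fourierCoeff_add (contDiff_pull ω).continuous (contDiff_pull η).continuous
  map_smul' c _ := fourierCoeff_smul c

theorem formCoeff_injective {ω η : SmoothForm Λ p}
    (h : ∀ ξ ∈ reciprocalLattice Λ, formCoeff Λ p ξ ω = formCoeff Λ p ξ η) : ω = η := by
  refine sub_eq_zero.1 (pull_injective (eq_zero_of_fourierCoeff_eq_zero
    (contDiff_pull (ω - η)).continuous (fun x _ => pull_add_lattice _ x) fun ξ hξ => ?_))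
  exact (map_sub (formCoeff Λ p ξ) ω η).trans (sub_eq_zero.2 (h ξ hξ))

theorem fourierCoeff_fderiv_pull (hξ : ξ ∈ reciprocalLattice Λ) (ω : SmoothForm Λ p) :
    fourierCoeff Λ ξ (fderiv ℝ (pull ω)) =
      (innerSL ℝ ξ).smulRight (Complex.I • formCoeff Λ p ξ ω) :=
  fourierCoeff_fderiv hξ (contDiff_pull ω) fun x _ => pull_add_lattice ω x

theorem formCoeff_d (hξ : ξ ∈ reciprocalLattice Λ) (ω : SmoothForm Λ p) :
    formCoeff Λ (p + 1) ξ (d p ω) = Complex.I • wedge p ξ (formCoeff Λ p ξ ω) := by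
  have commutes := fourierCoeff_comp (Λ := Λ) (ξ := ξ) (f := fderiv ℝ (pull ω))
    (ContinuousAlternatingMap.alternatizeUncurryFinCLM ℝ (Euc n) ℂ)
    (fun c a => ContinuousAlternatingMap.alternatizeUncurryFin_smul c a) (continuous_fderiv_pull ω)
  rw [fourierCoeff_fderiv_pull hξ] at commutes
  exact commutes.trans (map_smul (wedge p ξ) Complex.I _)

/-- The trace `∑ᵢ ∂ᵢ ⌟ A(∂ᵢ)` of a linear map from vectors to forms, of which the co-derivative is
minus the value at the derivative. -/
def interiorTrace (n p : ℕ) : (Euc n →L[ℝ] AltForm n (p + 1)) →L[ℝ] AltForm n p :=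
  ∑ i : Fin n, ((interior p).flip (stdVec i)).comp
    (ContinuousLinearMap.apply ℝ (AltForm n (p + 1)) (stdVec i))

theorem interiorTrace_apply (A : Euc n →L[ℝ] AltForm n (p + 1)) :
    interiorTrace n p A = ∑ i, interior p (A (stdVec i)) (stdVec i) := by
  simp only [interiorTrace, sum_apply]
  rfl

theorem interiorTrace_smul (c : ℂ) (A : Euc n →L[ℝ] AltForm n (p + 1)) :
    interiorTrace n p (c • A) = c • interiorTrace n p A := by
  simp only [interiorTrace_apply, Finset.smul_sum]
  rfl

theorem interiorTrace_smulRight (ξ : Euc n) (a : AltForm n (p + 1)) :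
    interiorTrace n p ((innerSL ℝ ξ).smulRight a) = contract p ξ a := by
  have expand : ξ = ∑ i, inner ℝ ξ (stdVec i) • stdVec i := by
    conv_lhs => rw [← (EuclideanSpace.basisFun (Fin n) ℝ).sum_repr' ξ]
    simp only [EuclideanSpace.basisFun_apply, real_inner_comm]
  conv_rhs => rw [expand]
  rw [interiorTrace_apply]
  change _ = interior p a _
  simp only [map_sum, map_smul]
  rfl

theorem formCoeff_codiff (hξ : ξ ∈ reciprocalLattice Λ) (ω : SmoothForm Λ (p + 1)) :
    formCoeff Λ p ξ (codiff p ω) = -Complex.I • contract p ξ (formCoeff Λ (p + 1) ξ ω) := by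
  have codiff_eq : pull (codiff p ω) =
      (-1 : ℂ) • fun x => interiorTrace n p (fderiv ℝ (pull ω) x) := by
    funext x
    rw [Pi.smul_apply, interiorTrace_apply]
    exact (neg_one_smul ℂ _).symm
  change fourierCoeff Λ ξ (pull (codiff p ω)) = _
  rw [codiff_eq, fourierCoeff_smul, fourierCoeff_comp (f := fderiv ℝ (pull ω)) (interiorTrace n p)
    interiorTrace_smul (continuous_fderiv_pull ω), fourierCoeff_fderiv_pull hξ,
    interiorTrace_smulRight, map_smul, smul_smul, neg_one_mul]

theorem formCoeff_F (hξ : ξ ∈ reciprocalLattice Λ) (α β : ℝ) (ω : SmoothForm Λ (p + 1)) :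
    formCoeff Λ (p + 1) ξ (F Λ α β (p + 1) ω) = symbol α β p ξ (formCoeff Λ (p + 1) ξ ω) := by
  have exact_part : formCoeff Λ (p + 1) ξ (d p (codiff p ω)) =
      wedge p ξ (contract p ξ (formCoeff Λ (p + 1) ξ ω)) := by
    rw [formCoeff_d hξ, formCoeff_codiff hξ, map_smul, smul_smul, mul_neg,
      Complex.I_mul_I, neg_neg, one_smul]
  have coexact_part : formCoeff Λ (p + 1) ξ (codiff (p + 1) (d (p + 1) ω)) =
      contract (p + 1) ξ (wedge (p + 1) ξ (formCoeff Λ (p + 1) ξ ω)) := by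
    rw [formCoeff_codiff hξ, formCoeff_d hξ, map_smul, smul_smul, neg_mul,
      Complex.I_mul_I, neg_neg, one_smul]
  simp only [F, symbol, LinearMap.add_apply, LinearMap.smul_apply, LinearMap.comp_apply, map_add,
    map_smul, exact_part, coexact_part]

theorem mem_Eig_iff {α β : ℝ} {μ : ℂ} {ω : SmoothForm Λ (p + 1)} :
    ω ∈ Eig Λ α β (p + 1) μ ↔ ∀ ξ ∈ reciprocalLattice Λ,
      formCoeff Λ (p + 1) ξ ω ∈ (symbol α β p ξ).eigenspace μ := by
  simp only [Eig, Module.End.mem_eigenspace_iff]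
  constructor
  · intro h ξ hξ
    rw [← formCoeff_F hξ, h, map_smul]
  · intro h
    refine formCoeff_injective fun ξ hξ => ?_
    rw [formCoeff_F hξ, map_smul, h ξ hξ]

/-- The form `exp (i ⟪ξ, x⟫) a` on the torus with constant coefficients `a`. -/
def waveForm (ξ : reciprocalLattice Λ) (a : AltForm n p) : SmoothForm Λ p :=
  descend (fun x => wave ξ x • a) ((contDiff_wave _).smul contDiff_const) fun x _ hv => by
    rw [wave_add_lattice ξ.2 x hv]

open scoped Classical in
theorem formCoeff_waveForm (ξ η : reciprocalLattice Λ) (a : AltForm n p) :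
    formCoeff Λ p ξ (waveForm η a) = if ξ = η then (ZLattice.covolume Λ : ℂ) • a else 0 := by
  simp only [← Subtype.coe_inj]
  exact fourierCoeff_wave_smul ξ.2 η.2 a

end FormCoeff

section Spectrum

open Module

variable {Λ : Submodule ℤ (Euc n)} [DiscreteTopology Λ] [IsZLattice ℝ Λ] {p : ℕ}

theorem exists_formCoeff_eq (S : Finset (reciprocalLattice Λ)) (a : S → AltForm n p) :
    ∃ ω : SmoothForm Λ p, (∀ ξ : S, formCoeff Λ p ξ ω = a ξ) ∧
      ∀ ξ ∉ S, formCoeff Λ p ξ ω = 0 := by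
  classical
  have covolume_ne_zero : (ZLattice.covolume Λ : ℂ) ≠ 0 :=
    Complex.ofReal_ne_zero.2 (ZLattice.covolume_ne_zero Λ MeasureTheory.volume)
  refine ⟨∑ η : S, waveForm η ((ZLattice.covolume Λ : ℂ)⁻¹ • a η), fun ξ => ?_, fun ξ hξ => ?_⟩
  · simp only [map_sum, formCoeff_waveForm, smul_inv_smul₀ covolume_ne_zero, Subtype.coe_inj,
      Finset.sum_ite_eq, Finset.mem_univ, if_true]
  · simp only [map_sum, formCoeff_waveForm]
    exact Finset.sum_eq_zero fun η _ => if_neg fun h => hξ (by rw [h]; exact η.2)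

theorem Spec_eq_sum {α β : ℝ} {μ : ℂ} (S : Finset (reciprocalLattice Λ))
    (hS : ∀ ξ ∉ S, (symbol α β p (ξ : Euc n)).eigenspace μ = ⊥) :
    Spec Λ α β (p + 1) μ =
      (∑ ξ ∈ S, finrank ℂ ((symbol α β p (ξ : Euc n)).eigenspace μ) : ℕ) := by
  let restrictCoeff (ξ : S) :
      Eig Λ α β (p + 1) μ →ₗ[ℂ] (symbol α β p (ξ : Euc n)).eigenspace μ :=
    (formCoeff Λ (p + 1) (ξ : Euc n)).restrict fun _ h => mem_Eig_iff.1 h ξ ξ.1.2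
  have injective : Function.Injective (LinearMap.pi restrictCoeff) := fun ω η h => by
    refine Subtype.ext (formCoeff_injective fun ξ hξ => ?_)
    by_cases hξS : ⟨ξ, hξ⟩ ∈ S
    · exact congrArg Subtype.val (congrFun h ⟨_, hξS⟩)
    · have coeff_eq_zero (ω : Eig Λ α β (p + 1) μ) : formCoeff Λ (p + 1) ξ ω = 0 :=
        (Submodule.mem_bot ℂ).1 (hS _ hξS ▸ mem_Eig_iff.1 ω.2 ξ hξ)
      rw [coeff_eq_zero, coeff_eq_zero]
  have surjective : Function.Surjective (LinearMap.pi restrictCoeff) := fun a => by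
    obtain ⟨ω, hω, hω'⟩ := exists_formCoeff_eq S fun ξ => (a ξ : AltForm n (p + 1))
    refine ⟨⟨ω, mem_Eig_iff.2 fun ξ hξ => ?_⟩, funext fun ξ => Subtype.ext (hω ξ)⟩
    by_cases hξS : ⟨ξ, hξ⟩ ∈ S
    · exact (hω ⟨_, hξS⟩).symm ▸ (a ⟨_, hξS⟩).2
    · exact (hω' _ hξS).symm ▸ zero_mem _
  refine (LinearEquiv.ofBijective _ ⟨injective, surjective⟩).rank_eq.trans ?_
  rw [← finrank_eq_rank, finrank_pi_fintype, ← Finset.sum_coe_sort S]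

open scoped Classical in
theorem sum_ite_normSq_eq {L : Submodule ℤ (Euc n)} {r : ℝ} (hr : r ≠ 0) {μ : ℂ} {S : Finset L}
    (hS : ∀ ξ : L, μ = ((r * ‖(ξ : Euc n)‖ ^ 2 : ℝ) : ℂ) → ξ ∈ S) (m : ℕ) :
    (∑ ξ ∈ S, if μ = ((r * ‖(ξ : Euc n)‖ ^ 2 : ℝ) : ℂ) then m else 0) =
      m * lengthCount L (r⁻¹ • μ) := by
  have normSq_eq_iff (ξ : Euc n) :
      μ = ((r * ‖ξ‖ ^ 2 : ℝ) : ℂ) ↔ ((‖ξ‖ ^ 2 : ℝ) : ℂ) = r⁻¹ • μ := by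
    rw [eq_comm, Complex.ofReal_mul, ← Complex.real_smul, eq_inv_smul_iff₀ hr]
  rw [← Finset.sum_filter, Finset.sum_const, smul_eq_mul, mul_comm, lengthCount,
    ← Set.ncard_coe_finset, ← Set.ncard_image_of_injective _ Subtype.val_injective]
  congr 2
  ext ξ
  simp only [Set.mem_image, Finset.mem_coe, Finset.mem_filter, Subtype.exists, ← normSq_eq_iff]
  exact ⟨by rintro ⟨_, hξ, h, rfl⟩; exact ⟨hξ, h.2⟩, fun h => ⟨ξ, h.1, ⟨hS ⟨ξ, h.1⟩ h.2, h.2⟩, rfl⟩⟩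

theorem finite_normSq_mul_eq (L : Submodule ℤ (Euc n)) [DiscreteTopology L] {r : ℝ} (hr : r ≠ 0)
    (μ : ℂ) : {ξ : L | μ = ((r * ‖(ξ : Euc n)‖ ^ 2 : ℝ) : ℂ)}.Finite := by
  refine ((finite_normSq_eq L (r⁻¹ • μ)).preimage Subtype.val_injective.injOn).subset fun ξ hξ => ?_
  refine ⟨ξ.2, ?_⟩
  rw [hξ, Complex.real_smul, ← Complex.ofReal_mul, inv_mul_cancel_left₀ hr]

theorem Spec_eq_lengthCount (hn : n ≠ 0) {α β : ℝ} (hα : α ≠ 0) (hβ : β ≠ 0) (μ : ℂ) :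
    Spec Λ α β (p + 1) μ =
      ((n - 1).choose p * lengthCount (reciprocalLattice Λ) (α⁻¹ • μ) +
        (n - 1).choose (p + 1) * lengthCount (reciprocalLattice Λ) (β⁻¹ • μ) : ℕ) := by
  classical
  let S := (finite_normSq_mul_eq (reciprocalLattice Λ) hα μ).toFinset ∪
    (finite_normSq_mul_eq (reciprocalLattice Λ) hβ μ).toFinset
  have mem_S (ξ : reciprocalLattice Λ) : ξ ∈ S ↔ μ = ((α * ‖(ξ : Euc n)‖ ^ 2 : ℝ) : ℂ) ∨
      μ = ((β * ‖(ξ : Euc n)‖ ^ 2 : ℝ) : ℂ) := by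
    simp only [S, Finset.mem_union, Set.Finite.mem_toFinset, Set.mem_ofPred_eq]
  have eigenspace_eq_bot (ξ) (hξ : ξ ∉ S) : (symbol α β p (ξ : Euc n)).eigenspace μ = ⊥ := by
    obtain ⟨h, h'⟩ := not_or.1 (mt (mem_S ξ).2 hξ)
    rw [← Submodule.finrank_eq_zero (R := ℂ), finrank_eigenspace_symbol hn, if_neg h, if_neg h']
  rw [Spec_eq_sum S eigenspace_eq_bot]
  simp only [finrank_eigenspace_symbol hn, Finset.sum_add_distrib]
  rw [sum_ite_normSq_eq hα fun ξ h => (mem_S ξ).2 (.inl h),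
    sum_ite_normSq_eq hβ fun ξ h => (mem_S ξ).2 (.inr h)]

end Spectrum

section Isospectrality

variable (Λ : Submodule ℤ (Euc n)) [DiscreteTopology Λ] [IsZLattice ℝ Λ] {α β α' β' : ℝ}

open Finsupp in
theorem isospectral_iff (hn : n ≠ 0) (p : ℕ) (hα : α ≠ 0) (hβ : β ≠ 0) (hα' : α' ≠ 0)
    (hβ' : β' ≠ 0) :
    Isospectral Λ (p + 1) α β α' β' ↔
      single α ((n - 1).choose p : ℤ) + single β ((n - 1).choose (p + 1) : ℤ) =
        single α' ((n - 1).choose p : ℤ) + single β' ((n - 1).choose (p + 1) : ℤ) := by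
  have mem_supported {a b : ℝ} (ha : a ≠ 0) (hb : b ≠ 0) (A B : ℤ) :
      single a A + single b B ∈ supported ℤ ℤ ({0}ᶜ : Set ℝ) :=
    add_mem (single_mem_supported _ _ ha) (single_mem_supported _ _ hb)
  have injOn := linearIndepOn_iffₛ.1 (linearIndepOn_dilate_lengthCount (reciprocalLattice Λ) hn)
  rw [← (show _ ↔ _ from ⟨injOn _ (mem_supported hα hβ _ _) _ (mem_supported hα' hβ' _ _),
    fun h => congrArg _ h⟩), Isospectral, funext_iff, funext_iff]
  refine forall_congr' fun μ => ?_
  rw [Spec_eq_lengthCount hn hα hβ, Spec_eq_lengthCount hn hα' hβ', Nat.cast_inj,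
    ← Nat.cast_inj (R := ℤ)]
  simp [dilate]

theorem choose_pred_eq_choose_pred_succ_iff {n p : ℕ} (hp : p + 1 < n) :
    (n - 1).choose p = (n - 1).choose (p + 1) ↔ n = 2 * (p + 1) := by
  constructor
  · intro h
    have ratio := Nat.choose_succ_right_eq (n - 1) p
    rw [← h] at ratio
    have := Nat.eq_of_mul_eq_mul_left (Nat.choose_pos (by lia)) ratio
    lia
  · rintro rfl
    exact Nat.choose_symm_of_eq_add (by lia)

end Isospectrality

end FlatTorus

end

open FlatTorus Finsupp in
theorem mainTheorem4_general {n : ℕ} (Λ : Submodule ℤ (Euc n)) [DiscreteTopology Λ]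
    [IsZLattice ℝ Λ] (p : ℕ) (hp : 1 ≤ p) (hpn : p ≤ n) (α β α' β' : ℝ) (hα : α ≠ 0) (hβ : β ≠ 0)
    (hα' : α' ≠ 0) (hβ' : β' ≠ 0) :
    (p < n → n ≠ 2 * p → (Isospectral Λ p α β α' β' ↔ (α, β) = (α', β'))) ∧
    (n = 2 * p → (Isospectral Λ p α β α' β' ↔ ({α, β} : Set ℝ) = {α', β'})) ∧
    (p = n → (Isospectral Λ p α β α' β' ↔ α = α')) := by
  obtain ⟨p, rfl⟩ := Nat.exists_eq_add_of_le' hp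
  have A_ne_zero : ((n - 1).choose p : ℤ) ≠ 0 :=
    Nat.cast_ne_zero.2 (Nat.choose_pos (Nat.le_sub_one_of_lt hpn)).ne'
  rw [isospectral_iff Λ (by lia) p hα hβ hα' hβ']
  refine ⟨fun hlt hne => ?_, fun h => ?_, fun h => ?_⟩
  · have B_ne_zero : ((n - 1).choose (p + 1) : ℤ) ≠ 0 :=
      Nat.cast_ne_zero.2 (Nat.choose_pos (Nat.le_sub_one_of_lt hlt)).ne'
    have A_ne_B := mt (choose_pred_eq_choose_pred_succ_iff hlt).1 hne
    rw [single_add_single_eq_single_add_single A_ne_zero B_ne_zero, Prod.mk_inj]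
    lia
  · rw [← (choose_pred_eq_choose_pred_succ_iff (by lia)).2 h,
      single_add_single_eq_single_add_single A_ne_zero A_ne_zero, Set.pair_eq_pair_iff]
    lia
  · rw [Nat.choose_eq_zero_of_lt (k := p + 1) (by lia), Nat.cast_zero, single_zero, single_zero,
      add_zero, add_zero, single_left_inj A_ne_zero]

theorem mainTheorem4 {n : ℕ} (Λ : Submodule ℤ (EuclideanSpace ℝ (Fin n)))
    [DiscreteTopology Λ] [IsZLattice ℝ Λ] (p : ℕ) (hp : 1 ≤ p) (hpn : p ≤ n)
    (α β α' β' : ℝ) (hα : 0 < α) (hβ : 0 < β) (hα' : 0 < α') (hβ' : 0 < β') :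
    (p < n → n ≠ 2 * p →
      (FlatTorus.Isospectral Λ p α β α' β' ↔ (α, β) = (α', β'))) ∧
    (n = 2 * p →
      (FlatTorus.Isospectral Λ p α β α' β' ↔ ({α, β} : Set ℝ) = {α', β'})) ∧
    (p = n → (FlatTorus.Isospectral Λ p α β α' β' ↔ α = α')) :=
  mainTheorem4_general Λ p hp hpn α β α' β' hα.ne' hβ.ne' hα'.ne' hβ'.ne'
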